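/- Let $\mathcal H$ be a complex Hilbert space of dimension $n$ with $3 \le n < \infty$, and let $\mathcal P(\mathcal H)$ be the set of (orthogonal) projections on $\mathcal H$, i.e. of operators $P$ with $P = P^* = P^2$. For operators $A_1, A_2$ on $\mathcal H$ let $$\sigma([A_1, A_2]) = \{(c_1, c_2) \in \mathbb C^2 : c_1 A_1 + c_2 A_2 \text{ is not invertible in } \mathcal B(\mathcal H)\}$$ be their joint spectrum. Let $\varphi : \mathcal P(\mathcal H) \to \mathcal P(\mathcal H)$ be a surjective map. Then the following are equivalent. (1) $\varphi$ shrinks the joint spectrum of any two projections: $\sigma([\varphi(P), \varphi(Q)]) \subseteq \sigma([P, Q])$ for all $P, Q \in \mathcal P(\mathcal H)$. (2) $\varphi$ preserves the joint spectrum of any two projections: $\sigma([\varphi(P), \varphi(Q)]) = \sigma([P, Q])$ for all $P, Q \in \mathcal P(\mathcal H)$. (3) There exist an orthonormal basis $\alpha_1, \dots, \alpha_n$ of $\mathcal H$, a (not necessarily orthonormal) basis $\beta_1, \dots, \beta_n$ of $\mathcal H$ and a ring automorphism $f$ of $\mathbb C$ such that $$\varphi(P)(\mathcal H) = \{\hat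 f(P\xi) : \xi \in \mathcal H\} \quad \text{for all } P \in \mathcal P(\mathcal H),$$ where $\hat f : \mathcal H \to \mathcal H$ is the map $$\hat f(z_1 \alpha_1 + \dots + z_n \alpha_n) = f(z_1) \beta_1 + \dots + f(z_n) \beta_n .$$ -/

import Mathlib

/-- The set `𝒫(H)` of (orthogonal, i.e. self-adjoint idempotent) projections on a complex
Hilbert space `H`. -/
abbrev Projections (H : Type*) [NormedAddCommGroup H] [InnerProductSpace ℂ H]
    [CompleteSpace H] : Type _ :=
  {P : H →L[ℂ] H // IsStarProjection P}

/-- The joint spectrum of a tuple `A₁, …, A_l` of bounded operators on `H`: the set of all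
`(c₁, …, c_l) ∈ ℂ^l` such that `c₁ A₁ + ⋯ + c_l A_l` is not invertible in `B(H)`. -/
def jointSpectrum {H : Type*} [NormedAddCommGroup H] [InnerProductSpace ℂ H] {l : ℕ}
    (A : Fin l → (H →L[ℂ] H)) : Set (Fin l → ℂ) :=
  {c | ¬ IsUnit (∑ i, c i • A i)}

/-- `φ` shrinks the joint spectrum of any two projections. -/
def ShrinksJointSpectrumOfPairs {H : Type*} [NormedAddCommGroup H] [InnerProductSpace ℂ H]
    [CompleteSpace H] (φ : Projections H → Projections H) : Prop :=
  ∀ P Q : Projections H,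
    jointSpectrum ![(φ P).1, (φ Q).1] ⊆ jointSpectrum ![P.1, Q.1]

/-- `φ` preserves the joint spectrum of any two projections. -/
def PreservesJointSpectrumOfPairs {H : Type*} [NormedAddCommGroup H] [InnerProductSpace ℂ H]
    [CompleteSpace H] (φ : Projections H → Projections H) : Prop :=
  ∀ P Q : Projections H,
    jointSpectrum ![(φ P).1, (φ Q).1] = jointSpectrum ![P.1, Q.1]

/-- The map `f̂ : H → H`, `f̂ (z₁ α₁ + ⋯ + z_n α_n) = f z₁ β₁ + ⋯ + f z_n β_n`, induced by a ring
automorphism `f` of `ℂ`, an orthonormal basis `α` and a basis `β`. -/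
noncomputable def inducedMap {H : Type*} [NormedAddCommGroup H] [InnerProductSpace ℂ H] {n : ℕ}
    (α : OrthonormalBasis (Fin n) ℂ H) (β : Module.Basis (Fin n) ℂ H) (f : ℂ ≃+* ℂ) : H → H :=
  fun x => ∑ i, f (α.repr x i) • β i

/-! The joint spectrum of two projections sees only a little lattice data of their ranges. By
`isUnit_combination_iff`, invertibility of `a • P + b • Q` depends on whether the ranges span `H`,
whether they meet trivially (when `a + b = 0`), and whether one of them is all of `H` (when the
other coefficient vanishes). A semilinear bijection preserves all of this, so (3) gives (2), and (2)
trivially gives (1).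

For (1) to (3), the coefficients `(1, 1)` and `(1, -1)` show that the map induced by `φ` on
subspaces sends supplements to supplements and complements to complements. Such a surjection
preserves dimension (`PreservesComplements.finrank_map`), hence acts on lines and on hyperplanes. It
reflects and then preserves incidence of lines with hyperplanes (`representative_mem_iff`), so it
acts on lines as a collineation. In dimension at least 3 the fundamental theorem of projective
geometry (`RepresentsCollineation.exists_semilinear`) yields a semilinear bijection `T` inducing it
on lines, and complements extend the agreement to all subspaces. Finally `T` is `inducedMap α β σ`
with `α` an orthonormal basis and `β` its image under `T`. -/

section ProjectiveGeometry

/-! ### The fundamental theorem of projective geometry: normalizing representatives. -/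

variable {K V : Type*} [Field K] [AddCommGroup V] [Module K V]

theorem linearIndependent_triple_iff {x y z : V} :
    LinearIndependent K ![x, y, z] ↔
      ∀ r s t : K, r • x + s • y + t • z = 0 → r = 0 ∧ s = 0 ∧ t = 0 := by
  rw [Fintype.linearIndependent_iff]
  constructor
  · intro h r s t hrst
    have := h ![r, s, t] (by simpa [Fin.sum_univ_three] using hrst)
    exact ⟨this 0, this 1, this 2⟩
  · intro h c hc
    obtain ⟨h0, h1, h2⟩ := h (c 0) (c 1) (c 2) (by simpa [Fin.sum_univ_three] using hc)
    intro i
    fin_cases i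
    exacts [h0, h1, h2]

theorem mem_span_singleton_of_mem_of_ne_zero {x y : V} (h : x ∈ Submodule.span K {y})
    (hx : x ≠ 0) : y ∈ Submodule.span K {x} := by
  obtain ⟨c, rfl⟩ := Submodule.mem_span_singleton.1 h
  have hc : c ≠ 0 := by rintro rfl; simp at hx
  exact Submodule.mem_span_singleton.2 ⟨c⁻¹, by simp [smul_smul, hc]⟩

/-- A map on vectors representing an injective collineation of the projective space. -/
structure RepresentsCollineation (K : Type*) {V : Type*} [Field K] [AddCommGroup V] [Module K V]
    (g : V → V) : Prop where
  map_zero : g 0 = 0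
  collinear : ∀ x u v : V, x ∈ Submodule.span K {u, v} → g x ∈ Submodule.span K {g u, g v}
  linearIndependent : ∀ {m : ℕ} (v : Fin m → V),
    LinearIndependent K v → LinearIndependent K (g ∘ v)
  surjective : ∀ z : V, ∃ w : V, z ∈ Submodule.span K {g w}

namespace RepresentsCollineation

variable {g : V → V}

theorem ne_zero (hg : RepresentsCollineation K g) {x : V} (hx : x ≠ 0) : g x ≠ 0 := by
  have h : LinearIndependent K ![x] := by simpa [linearIndependent_unique_iff] using hx
  exact (hg.linearIndependent _ h).ne_zero 0

theorem linearIndependent_pair (hg : RepresentsCollineation K g) {x y : V}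
    (h : LinearIndependent K ![x, y]) : LinearIndependent K ![g x, g y] := by
  have := hg.linearIndependent _ h
  rwa [show g ∘ ![x, y] = ![g x, g y] by ext i; fin_cases i <;> rfl] at this

theorem linearIndependent_triple (hg : RepresentsCollineation K g) {x y z : V}
    (h : LinearIndependent K ![x, y, z]) : LinearIndependent K ![g x, g y, g z] := by
  have := hg.linearIndependent _ h
  rwa [show g ∘ ![x, y, z] = ![g x, g y, g z] by ext i; fin_cases i <;> rfl] at this

theorem mem_span_singleton (hg : RepresentsCollineation K g) {x y : V}
    (h : x ∈ Submodule.span K {y}) : g x ∈ Submodule.span K {g y} := by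
  simpa using hg.collinear x y y (by simpa using h)

/-- The representative of the image of `x` determined by the choice of `g a` as a representative
of the image of `a`. -/
theorem exists_adjusted (hg : RepresentsCollineation K g) {a x : V}
    (h : LinearIndependent K ![x, a]) :
    ∃ y ∈ Submodule.span K {g x}, y + g a ∈ Submodule.span K {g (x + a)} := by
  obtain ⟨p, q, hpq⟩ := Submodule.mem_span_pair.1 (hg.collinear (x + a) x a
    (Submodule.mem_span_pair.2 ⟨1, 1, by simp⟩))
  have hind : LinearIndependent K ![x, x + a] := by
    simpa using h
  have hq : q ≠ 0 := by
    rintro rfl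
    have := (LinearIndependent.pair_iff.1 (hg.linearIndependent_pair hind)) p (-1)
      (by linear_combination (norm := module) hpq)
    simp at this
  refine ⟨(q⁻¹ * p) • g x, Submodule.mem_span_singleton.2 ⟨_, rfl⟩,
    Submodule.mem_span_singleton.2 ⟨q⁻¹, ?_⟩⟩
  rw [← hpq, smul_add, smul_smul, smul_smul, inv_mul_cancel₀ hq, one_smul]

/-- The lines of `g x` and `g (x + a)` are distinct, so a translate of one by `g a` meets the other
in at most one point. -/
theorem adjusted_unique (hg : RepresentsCollineation K g) {a x y y' : V}
    (h : LinearIndependent K ![x, a])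
    (hy : y ∈ Submodule.span K {g x}) (hya : y + g a ∈ Submodule.span K {g (x + a)})
    (hy' : y' ∈ Submodule.span K {g x}) (hya' : y' + g a ∈ Submodule.span K {g (x + a)}) :
    y = y' := by
  obtain ⟨p, rfl⟩ := Submodule.mem_span_singleton.1 hy
  obtain ⟨p', rfl⟩ := Submodule.mem_span_singleton.1 hy'
  obtain ⟨q, hq⟩ := Submodule.mem_span_singleton.1 hya
  obtain ⟨q', hq'⟩ := Submodule.mem_span_singleton.1 hya'
  have hind : LinearIndependent K ![x, x + a] := by
    simpa using h
  have := (LinearIndependent.pair_iff.1 (hg.linearIndependent_pair hind)) (p - p') (q' - q)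
      (by linear_combination (norm := module) hq' - hq)
  rw [sub_eq_zero.1 this.1]

/-- `f` is a lift of the collineation represented by `g` to the affine hyperplane `W + a`, identified
with `W`. -/
structure IsAffineLift (g : V → V) (W : Submodule K V) (a : V) (f : V → V) : Prop where
  map_zero : f 0 = 0
  mem_span : ∀ x ∈ W, f x ∈ Submodule.span K {g x}
  add_mem_span : ∀ x ∈ W, f x + g a ∈ Submodule.span K {g (x + a)}

theorem linearIndependent_pair_of_notMem {W : Submodule K V} {a x : V} (ha : a ∉ W) (hx : x ∈ W)
    (hx0 : x ≠ 0) : LinearIndependent K ![x, a] := by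
  rw [LinearIndependent.pair_iff' hx0]
  rintro c rfl
  exact ha (W.smul_mem c hx)

theorem linearIndependent_triple_of_notMem {W : Submodule K V} {a x y : V} (ha : a ∉ W)
    (hx : x ∈ W) (hy : y ∈ W) (h : LinearIndependent K ![x, y]) :
    LinearIndependent K ![x, y, a] := by
  rw [linearIndependent_triple_iff]
  intro r s t hrst
  have ht : t = 0 := by
    by_contra ht
    apply ha
    rw [← W.smul_mem_iff ht]
    have : t • a = -(r • x + s • y) := by linear_combination (norm := module) hrst
    rw [this]
    exact W.neg_mem (W.add_mem (W.smul_mem _ hx) (W.smul_mem _ hy))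
  subst ht
  have := LinearIndependent.pair_iff.1 h r s (by simpa using hrst)
  exact ⟨this.1, this.2, rfl⟩

theorem exists_isAffineLift (hg : RepresentsCollineation K g) {W : Submodule K V} {a : V}
    (ha : a ∉ W) : ∃ f : V → V, IsAffineLift g W a f := by
  have h : ∀ x : V, ∃ y, (x = 0 → y = 0) ∧ (x ∈ W → y ∈ Submodule.span K {g x} ∧
      y + g a ∈ Submodule.span K {g (x + a)}) := by
    intro x
    by_cases hx0 : x = 0
    · subst hx0
      exact ⟨0, fun _ => rfl, fun _ => ⟨zero_mem _, by simp [Submodule.mem_span_singleton_self]⟩⟩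
    · by_cases hx : x ∈ W
      · obtain ⟨y, h1, h2⟩ := hg.exists_adjusted (linearIndependent_pair_of_notMem ha hx hx0)
        exact ⟨y, fun h => absurd h hx0, fun _ => ⟨h1, h2⟩⟩
      · exact ⟨0, fun _ => rfl, fun h => absurd h hx⟩
  choose f hf using h
  exact ⟨f, (hf 0).1 rfl, fun x hx => ((hf x).2 hx).1, fun x hx => ((hf x).2 hx).2⟩

/-! ### Additivity of the affine lift. -/

namespace IsAffineLift

variable {W : Submodule K V} {a : V} {f : V → V}

theorem unique (hf : IsAffineLift g W a f) (hg : RepresentsCollineation K g) (ha : a ∉ W) {x y : V}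
    (hx : x ∈ W) (hx0 : x ≠ 0) (hy : y ∈ Submodule.span K {g x})
    (hya : y + g a ∈ Submodule.span K {g (x + a)}) : f x = y :=
  hg.adjusted_unique (linearIndependent_pair_of_notMem ha hx hx0) (hf.mem_span x hx)
    (hf.add_mem_span x hx) hy hya

theorem ne_zero (hf : IsAffineLift g W a f) (hg : RepresentsCollineation K g) (ha : a ∉ W) {x : V}
    (hx : x ∈ W) (hx0 : x ≠ 0) : f x ≠ 0 := by
  intro h
  obtain ⟨c, hc⟩ := Submodule.mem_span_singleton.1 (hf.add_mem_span x hx)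
  have hind : LinearIndependent K ![x + a, a] := by
    simpa using linearIndependent_pair_of_notMem ha hx hx0
  have := LinearIndependent.pair_iff.1 (hg.linearIndependent_pair hind) c (-1)
    (by rw [hc, h]; module)
  simp at this

theorem mem_span_lift (hf : IsAffineLift g W a f) (hg : RepresentsCollineation K g) (ha : a ∉ W)
    {x : V} (hx : x ∈ W) : g x ∈ Submodule.span K {f x} := by
  by_cases hx0 : x = 0
  · simp [hx0, hg.map_zero]
  · exact mem_span_singleton_of_mem_of_ne_zero (hf.mem_span x hx) (hf.ne_zero hg ha hx hx0)

theorem linearIndependent_pair (hf : IsAffineLift g W a f) (hg : RepresentsCollineation K g)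
    (ha : a ∉ W) {x : V} (hx : x ∈ W) (hx0 : x ≠ 0) : LinearIndependent K ![f x, g a] := by
  have h := hg.linearIndependent_pair (linearIndependent_pair_of_notMem ha hx hx0)
  obtain ⟨c, hc⟩ := Submodule.mem_span_singleton.1 (hf.mem_span x hx)
  have hc0 : c ≠ 0 := by
    rintro rfl
    exact hf.ne_zero hg ha hx hx0 (by simpa using hc.symm)
  rw [LinearIndependent.pair_iff] at h ⊢
  intro s t hst
  have := h (s * c) t (by rw [← hst, ← hc, smul_smul])
  simpa [hc0] using this

theorem linearIndependent_triple (hf : IsAffineLift g W a f) (hg : RepresentsCollineation K g)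
    (ha : a ∉ W) {x y : V} (hx : x ∈ W) (hy : y ∈ W) (hxy : LinearIndependent K ![x, y]) :
    LinearIndependent K ![f x, f y, g a] := by
  have h := hg.linearIndependent_triple (linearIndependent_triple_of_notMem ha hx hy hxy)
  obtain ⟨c, hc⟩ := Submodule.mem_span_singleton.1 (hf.mem_span x hx)
  obtain ⟨d, hd⟩ := Submodule.mem_span_singleton.1 (hf.mem_span y hy)
  have hc0 : c ≠ 0 := by
    rintro rfl
    exact hf.ne_zero hg ha hx (hxy.ne_zero 0) (by simpa using hc.symm)
  have hd0 : d ≠ 0 := by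
    rintro rfl
    exact hf.ne_zero hg ha hy (hxy.ne_zero 1) (by simpa using hd.symm)
  rw [linearIndependent_triple_iff] at h ⊢
  intro r s t hst
  have := h (r * c) (s * d) t (by rw [← hst, ← hc, ← hd, smul_smul, smul_smul])
  simpa [hc0, hd0] using this

theorem mem_span_lift_add (hf : IsAffineLift g W a f) (hg : RepresentsCollineation K g)
    (ha : a ∉ W) {x : V} (hx : x ∈ W) : g (x + a) ∈ Submodule.span K {f x + g a} := by
  refine mem_span_singleton_of_mem_of_ne_zero (hf.add_mem_span x hx) fun h => ?_
  by_cases hx0 : x = 0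
  · subst hx0
    rw [hf.map_zero, zero_add] at h
    exact hg.ne_zero (fun h0 : a = 0 => ha (h0 ▸ W.zero_mem)) h
  · have := LinearIndependent.pair_iff.1 (hf.linearIndependent_pair hg ha hx hx0) 1 1
      (by simpa using h)
    simp at this

/-- The parallelogram construction: collineations preserve the incidences that define vector
addition in the affine chart `W + a`. -/
theorem map_add_of_linearIndependent (hf : IsAffineLift g W a f) (hg : RepresentsCollineation K g)
    (ha : a ∉ W) {x y : V} (hx : x ∈ W) (hy : y ∈ W) (hxy : LinearIndependent K ![x, y]) :
    f (x + y) = f x + f y := by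
  have h3 := linearIndependent_triple_iff.1 (hf.linearIndependent_triple hg ha hx hy hxy)
  have hxy0 : x + y ≠ 0 := by
    intro h
    have := LinearIndependent.pair_iff.1 hxy 1 1 (by simpa using h)
    simp at this
  have hsum0 : x + y + a ≠ 0 := by
    intro h
    refine ha ?_
    rw [← neg_eq_of_add_eq_zero_right h]
    exact W.neg_mem (W.add_mem hx hy)
  have hspan : ∀ {u v w u' v' : V}, w = u + v → g u ∈ Submodule.span K {u'} →
      g v ∈ Submodule.span K {v'} → ∃ p q : K, g w = p • u' + q • v' := by
    rintro u v w u' v' rfl hu hv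
    obtain ⟨p, q, hpq⟩ := Submodule.mem_span_pair.1 (hg.collinear (u + v) u v
      (Submodule.mem_span_pair.2 ⟨1, 1, by simp⟩))
    obtain ⟨c, hc⟩ := Submodule.mem_span_singleton.1 hu
    obtain ⟨d, hd⟩ := Submodule.mem_span_singleton.1 hv
    exact ⟨p * c, q * d, by rw [← hpq, ← hc, ← hd, smul_smul, smul_smul]⟩
  -- The point `x + y + a` lies on the line through `x + a` and `y` and on the line through `x` and
  -- `y + a`. Comparing the two expansions in `f x`, `f y`, `g a` makes all coefficients equal.
  obtain ⟨p, q, h1⟩ := hspan (w := x + y + a) (by abel) (hf.mem_span_lift_add hg ha hx)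
    (hf.mem_span_lift hg ha hy)
  obtain ⟨r, s, h2⟩ := hspan (w := x + y + a) (by abel) (hf.mem_span_lift hg ha hx)
    (hf.mem_span_lift_add hg ha hy)
  obtain ⟨e1, e2, e3⟩ := h3 (p - r) (q - s) (p - s)
    (by linear_combination (norm := module) h2 - h1)
  obtain rfl : p = r := sub_eq_zero.1 e1
  obtain rfl : p = s := sub_eq_zero.1 e3
  obtain rfl : q = p := sub_eq_zero.1 e2
  have hadd : g (x + y + a) ∈ Submodule.span K {f x + f y + g a} :=
    Submodule.mem_span_singleton.2 ⟨q, by rw [h1]; module⟩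
  -- Likewise `x + y` lies on the line through `x` and `y` and on the line through `x + y + a` and
  -- `a`, which forces `g (x + y)` to be a multiple of `f x + f y`.
  obtain ⟨s, t, h4⟩ := hspan (w := x + y) rfl (hf.mem_span_lift hg ha hx)
    (hf.mem_span_lift hg ha hy)
  obtain ⟨u, v, h5⟩ := hspan (w := x + y) (u := x + y + a) (v := (-1 : K) • a)
    (v' := g a) (by module) hadd
    (hg.mem_span_singleton (Submodule.mem_span_singleton.2 ⟨_, rfl⟩))
  obtain ⟨e1, e2, -⟩ := h3 (s - u) (t - u) (-(u + v))
    (by linear_combination (norm := module) h5 - h4)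
  obtain rfl : s = u := sub_eq_zero.1 e1
  obtain rfl : t = s := sub_eq_zero.1 e2
  refine hf.unique hg ha (W.add_mem hx hy) hxy0 ?_ ?_
  · refine mem_span_singleton_of_mem_of_ne_zero ?_ (hg.ne_zero hxy0)
    exact Submodule.mem_span_singleton.2 ⟨t, by rw [h4]; module⟩
  · exact mem_span_singleton_of_mem_of_ne_zero hadd (hg.ne_zero hsum0)

end IsAffineLift

end RepresentsCollineation

end ProjectiveGeometry

/-! ### The field automorphism and the semilinear map. -/

namespace RepresentsCollineation

variable {K V : Type*} [Field K] [AddCommGroup V] [Module K V] {g : V → V}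

namespace IsAffineLift

variable {W : Submodule K V} {a : V} {f : V → V}

theorem exists_map_smul (hf : IsAffineLift g W a f) (hg : RepresentsCollineation K g)
    (ha : a ∉ W) {x : V} (hx : x ∈ W) (c : K) : ∃ t : K, f (c • x) = t • f x := by
  have h1 := hf.mem_span (c • x) (W.smul_mem c hx)
  have h2 : g (c • x) ∈ Submodule.span K {g x} :=
    hg.mem_span_singleton (Submodule.mem_span_singleton.2 ⟨c, rfl⟩)
  have h3 := hf.mem_span_lift hg ha hx
  rw [← Submodule.span_singleton_le_iff_mem] at h2 h3
  obtain ⟨t, ht⟩ := Submodule.mem_span_singleton.1 (h3 (h2 h1))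
  exact ⟨t, ht.symm⟩

/-- Expanding `f (c • (x + y))` in two ways shows that the scaling factors at `x`, `y` and `x + y`
agree. -/
theorem map_smul_congr (hf : IsAffineLift g W a f) (hg : RepresentsCollineation K g)
    (ha : a ∉ W) {x y : V} (hx : x ∈ W) (hy : y ∈ W) (hxy : LinearIndependent K ![x, y])
    {c t : K} (h : f (c • x) = t • f x) : f (c • y) = t • f y := by
  by_cases hc : c = 0
  · subst hc
    rw [zero_smul, hf.map_zero] at h ⊢
    rcases smul_eq_zero.1 h.symm with rfl | h
    · simp
    · exact absurd h (hf.ne_zero hg ha hx (hxy.ne_zero 0))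
  · obtain ⟨u, hu⟩ := hf.exists_map_smul hg ha hy c
    obtain ⟨v, hv⟩ := hf.exists_map_smul hg ha (W.add_mem hx hy) c
    have hcxy : LinearIndependent K ![c • x, c • y] :=
      (LinearIndependent.pair_smul_smul_iff (Ne.isUnit hc) (Ne.isUnit hc)).2 hxy
    have h1 := hf.map_add_of_linearIndependent hg ha (W.smul_mem c hx) (W.smul_mem c hy) hcxy
    rw [← smul_add, hv, hf.map_add_of_linearIndependent hg ha hx hy hxy, h, hu] at h1
    obtain ⟨e1, e2, -⟩ := linearIndependent_triple_iff.1
      (hf.linearIndependent_triple hg ha hx hy hxy) (v - t) (v - u) 0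
      (by linear_combination (norm := module) h1)
    rw [hu, ← sub_eq_zero.1 e1, sub_eq_zero.1 e2]

theorem exists_scalar_map (hf : IsAffineLift g W a f) (hg : RepresentsCollineation K g)
    (ha : a ∉ W) (hW : ∀ x ∈ W, x ≠ 0 → ∃ z ∈ W, LinearIndependent K ![x, z])
    (hW0 : ∃ x ∈ W, x ≠ 0) :
    ∃ σ : K → K, ∀ c, ∀ x ∈ W, f (c • x) = σ c • f x := by
  obtain ⟨x, hx, hx0⟩ := hW0
  obtain ⟨z, hz, hxz⟩ := hW x hx hx0
  choose σ hσ using fun c => hf.exists_map_smul hg ha hx c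
  refine ⟨σ, fun c y hy => ?_⟩
  by_cases hy0 : y = 0
  · simp [hy0, hf.map_zero]
  by_cases hxy : LinearIndependent K ![x, y]
  · exact hf.map_smul_congr hg ha hx hy hxy (hσ c)
  -- When `y` is a multiple of `x`, the factor is carried from `x` to `y` through the independent
  -- vector `z`.
  · have hzy : LinearIndependent K ![z, y] := by
      rw [LinearIndependent.pair_iff' hx0] at hxy
      push Not at hxy
      obtain ⟨d, rfl⟩ := hxy
      have hd : d ≠ 0 := by rintro rfl; simp at hy0
      rw [LinearIndependent.pair_symm_iff]
      simpa using (LinearIndependent.pair_smul_smul_iff (Ne.isUnit hd) isUnit_one).2 hxz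
    exact hf.map_smul_congr hg ha hz hy hzy (hf.map_smul_congr hg ha hx hz hxz (hσ c))

theorem exists_ringHom (hf : IsAffineLift g W a f) (hg : RepresentsCollineation K g)
    (ha : a ∉ W) (hW : ∀ x ∈ W, x ≠ 0 → ∃ z ∈ W, LinearIndependent K ![x, z])
    (hW0 : ∃ x ∈ W, x ≠ 0) :
    ∃ σ : K →+* K, ∀ c, ∀ x ∈ W, f (c • x) = σ c • f x := by
  obtain ⟨σ, hσ⟩ := hf.exists_scalar_map hg ha hW hW0
  obtain ⟨x, hx, hx0⟩ := hW0
  obtain ⟨z, hz, hxz⟩ := hW x hx hx0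
  have hfx := hf.ne_zero hg ha hx hx0
  have h0 : σ 0 = 0 := by
    have := hσ 0 x hx
    rw [zero_smul, hf.map_zero] at this
    exact (smul_eq_zero.1 this.symm).resolve_right hfx
  have h1 : σ 1 = 1 := by
    have := hσ 1 x hx
    rw [one_smul] at this
    exact smul_left_injective K hfx (by simpa using this.symm)
  have hmul : ∀ c d, σ (c * d) = σ c * σ d := by
    intro c d
    have := hσ (c * d) x hx
    rw [mul_smul, hσ c _ (W.smul_mem d hx), hσ d x hx, smul_smul] at this
    exact smul_left_injective K hfx this.symm
  have hz' : ∀ c, f (c • x + z) = σ c • f x + f z := by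
    intro c
    by_cases hc : c = 0
    · simp [hc, h0]
    · rw [hf.map_add_of_linearIndependent hg ha (W.smul_mem c hx) hz, hσ c x hx]
      simpa using (LinearIndependent.pair_smul_smul_iff (Ne.isUnit hc) isUnit_one).2 hxz
  have hadd : ∀ c d, σ (c + d) = σ c + σ d := by
    intro c d
    by_cases hc : c = 0
    · simp [hc, h0]
    -- Additivity of `f` is known only for independent vectors, so `z` is added to one of the two
    -- multiples of `x`.
    have hli : LinearIndependent K ![c • x, d • x + z] := by
      rw [LinearIndependent.pair_iff] at hxz ⊢
      intro s t hst
      have := hxz (s * c + t * d) t (by rw [← hst]; module)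
      obtain ⟨e, rfl⟩ := this
      simpa [hc] using e
    have := hf.map_add_of_linearIndependent hg ha (W.smul_mem c hx)
      (W.add_mem (W.smul_mem d hx) hz) hli
    rw [← add_assoc, ← add_smul, hz', hz', hσ c x hx, ← add_assoc, ← add_smul] at this
    exact smul_left_injective K hfx (add_right_cancel this)
  exact ⟨⟨⟨⟨σ, h1⟩, hmul⟩, h0, hadd⟩, hσ⟩

theorem map_add (hf : IsAffineLift g W a f) (hg : RepresentsCollineation K g)
    (ha : a ∉ W) {σ : K →+* K} (hσ : ∀ c, ∀ x ∈ W, f (c • x) = σ c • f x) {x y : V} (hx : x ∈ W)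
    (hy : y ∈ W) : f (x + y) = f x + f y := by
  by_cases hx0 : x = 0
  · simp [hx0, hf.map_zero]
  by_cases hxy : LinearIndependent K ![x, y]
  · exact hf.map_add_of_linearIndependent hg ha hx hy hxy
  · rw [LinearIndependent.pair_iff' hx0] at hxy
    push Not at hxy
    obtain ⟨d, rfl⟩ := hxy
    rw [show x + d • x = (1 + d) • x by module, hσ _ x hx, hσ _ x hx, RingHom.map_add,
      RingHom.map_one, add_smul, one_smul]

/-- The line of `t • f x + g a` is the image of a line in the plane of `x` and `a`; the affine
coordinate of that line is a preimage of `t`. -/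
theorem scalar_surjective (hf : IsAffineLift g W a f) (hg : RepresentsCollineation K g)
    (ha : a ∉ W) {σ : K →+* K} (hσ : ∀ c, ∀ x ∈ W, f (c • x) = σ c • f x)
    (hW0 : ∃ x ∈ W, x ≠ 0) : Function.Surjective σ := by
  obtain ⟨x, hx, hx0⟩ := hW0
  intro t
  have hfa := LinearIndependent.pair_iff.1 (hf.linearIndependent_pair hg ha hx hx0)
  obtain ⟨w, hw⟩ := hg.surjective (t • f x + g a)
  obtain ⟨k, hk⟩ := Submodule.mem_span_singleton.1 hw
  obtain ⟨p, hp⟩ := Submodule.mem_span_singleton.1 (hf.mem_span x hx)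
  have hxa := linearIndependent_pair_of_notMem ha hx hx0
  have hwmem : w ∈ Submodule.span K {x, a} := by
    by_contra hwn
    have hli : LinearIndependent K ![w, x, a] := by
      refine LinearIndependent.finCons (v := ![x, a]) hxa ?_
      simpa [Set.pair_comm] using hwn
    have := linearIndependent_triple_iff.1 (hg.linearIndependent_triple hli) k (-(t * p)) (-1)
      (by rw [hk, ← hp]; module)
    simp at this
  obtain ⟨c, m, rfl⟩ := Submodule.mem_span_pair.1 hwmem
  have hm : m ≠ 0 := by
    rintro rfl
    rw [zero_smul, add_zero] at hk
    obtain ⟨q, hq⟩ := Submodule.mem_span_singleton.1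
      (hf.mem_span_lift hg ha (W.smul_mem c hx))
    rw [← hq, hσ c x hx] at hk
    have := hfa (k * q * σ c - t) (-1) (by linear_combination (norm := module) hk)
    simp at this
  have h1 : g (c • x + m • a) ∈ Submodule.span K {g ((m⁻¹ * c) • x + a)} := by
    refine hg.mem_span_singleton (Submodule.mem_span_singleton.2 ⟨m, ?_⟩)
    rw [smul_add, smul_smul, mul_inv_cancel_left₀ hm]
  have h2 := hf.mem_span_lift_add hg ha (W.smul_mem (m⁻¹ * c) hx)
  obtain ⟨q, hq⟩ := Submodule.mem_span_singleton.1 h1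
  obtain ⟨r, hr⟩ := Submodule.mem_span_singleton.1 h2
  rw [← hq, ← hr, hσ _ x hx] at hk
  obtain ⟨e1, e2⟩ := hfa (k * q * r * σ (m⁻¹ * c) - t) (k * q * r - 1)
    (by linear_combination (norm := module) hk)
  rw [sub_eq_zero.1 e2, one_mul] at e1
  exact ⟨_, sub_eq_zero.1 e1⟩

end IsAffineLift

/-- The fundamental theorem of projective geometry. -/
theorem exists_semilinear (hg : RepresentsCollineation K g) (hV : 3 ≤ Module.finrank K V) :
    ∃ (σ : K ≃+* K) (T : V →ₛₗ[(σ : K →+* K)] V), Function.Bijective T ∧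
      ∀ v, g v ∈ Submodule.span K {T v} := by
  have hfin : FiniteDimensional K V := Module.finite_of_finrank_pos (by omega)
  have : Nontrivial V := Module.nontrivial_of_finrank_pos (R := K) (by omega)
  obtain ⟨a, ha0⟩ := exists_ne (0 : V)
  obtain ⟨l, hla⟩ : ∃ l : V →ₗ[K] K, l a = 1 := by
    obtain ⟨l, hl, -⟩ := Submodule.exists_le_ker_of_notMem (p := (⊥ : Submodule K V)) (v := a)
      (by simpa using ha0)
    exact ⟨(l a)⁻¹ • l, by simp [hl]⟩
  have ha : a ∉ LinearMap.ker l := by simp [hla]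
  have hrank : 2 ≤ Module.finrank K (LinearMap.ker l) := by
    have h1 := LinearMap.finrank_range_add_finrank_ker l
    have h2 := Submodule.finrank_le (LinearMap.range l)
    rw [Module.finrank_self] at h2
    omega
  have hW : ∀ x ∈ LinearMap.ker l, x ≠ 0 →
      ∃ z ∈ LinearMap.ker l, LinearIndependent K ![x, z] := by
    intro x hx hx0
    by_contra! h
    have hle : LinearMap.ker l ≤ Submodule.span K {x} := by
      intro z hz
      have := h z hz
      rw [LinearIndependent.pair_iff' hx0] at this
      push Not at this
      exact Submodule.mem_span_singleton.2 this
    have := Submodule.finrank_mono hle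
    rw [finrank_span_singleton hx0] at this
    omega
  have hW0 : ∃ x ∈ LinearMap.ker l, x ≠ 0 := by
    refine Submodule.exists_mem_ne_zero_of_ne_bot fun h => ?_
    rw [h, finrank_bot] at hrank
    omega
  obtain ⟨f, hf⟩ := hg.exists_isAffineLift ha
  obtain ⟨σ₀, hσ₀⟩ := hf.exists_ringHom hg ha hW hW0
  have hsurj := hf.scalar_surjective hg ha hσ₀ hW0
  obtain ⟨σ, rfl⟩ : ∃ σ : K ≃+* K, (σ : K →+* K) = σ₀ :=
    ⟨RingEquiv.ofBijective σ₀ ⟨σ₀.injective, hsurj⟩, RingHom.ext fun _ => rfl⟩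
  have hpr : ∀ v : V, v - l v • a ∈ LinearMap.ker l := fun v => by simp [hla]
  -- `V` splits as `ker l ⊕ K a`; `T` is `f` on the first summand and sends `a` to `g a`.
  let T : V →ₛₗ[(σ : K →+* K)] V :=
    { toFun := fun v => f (v - l v • a) + σ (l v) • g a
      map_add' := fun v w => by
        have : v + w - l (v + w) • a = (v - l v • a) + (w - l w • a) := by
          rw [_root_.map_add]; module
        rw [this, hf.map_add hg ha hσ₀ (hpr v) (hpr w), _root_.map_add, _root_.map_add]
        module
      map_smul' := fun c v => by
        have : c • v - l (c • v) • a = c • (v - l v • a) := by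
          rw [_root_.map_smul, smul_eq_mul]; module
        rw [this, hσ₀ c _ (hpr v), _root_.map_smul, smul_eq_mul, _root_.map_mul, smul_add,
          smul_smul]
        rfl }
  have hT : ∀ v, T v = f (v - l v • a) + σ (l v) • g a := fun v => rfl
  have hTspan : ∀ v, g v ∈ Submodule.span K {T v} := by
    intro v
    rw [hT]
    by_cases hl : l v = 0
    · rw [hl]
      simpa using hf.mem_span_lift hg ha (x := v) hl
    · have h1 : g v ∈ Submodule.span K {g ((l v)⁻¹ • (v - l v • a) + a)} := by
        refine hg.mem_span_singleton (Submodule.mem_span_singleton.2 ⟨l v, ?_⟩)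
        rw [smul_add, smul_smul, mul_inv_cancel₀ hl]
        module
      have h2 := hf.mem_span_lift_add hg ha (Submodule.smul_mem _ (l v)⁻¹ (hpr v))
      rw [hσ₀ _ _ (hpr v)] at h2
      rw [← Submodule.span_singleton_le_iff_mem] at h2
      obtain ⟨k, hk⟩ := Submodule.mem_span_singleton.1 (h2 h1)
      refine Submodule.mem_span_singleton.2 ⟨k * σ ((l v)⁻¹), ?_⟩
      rw [← hk, mul_smul, smul_add (σ _), smul_smul (σ _), ← _root_.map_mul, inv_mul_cancel₀ hl,
        _root_.map_one, one_smul]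
      rfl
  refine ⟨σ, T, ⟨?_, ?_⟩, hTspan⟩
  · rw [← LinearMap.ker_eq_bot, LinearMap.ker_eq_bot']
    intro v hv
    by_contra hv0
    have h1 := hTspan v
    rw [hv] at h1
    exact hg.ne_zero hv0 (by simpa using h1)
  · intro z
    obtain ⟨w, hw⟩ := hg.surjective z
    obtain ⟨c, rfl⟩ := Submodule.mem_span_singleton.1 hw
    obtain ⟨d, hd⟩ := Submodule.mem_span_singleton.1 (hTspan w)
    refine ⟨σ.symm (c * d) • w, ?_⟩
    rw [LinearMap.map_smulₛₗ, ← hd, smul_smul]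
    simp

end RepresentsCollineation

/-! ### Complements, common supplements and hyperplanes. -/

namespace Submodule

variable {K V : Type*} [Field K] [AddCommGroup V] [Module K V]

theorem finrank_sup_span_singleton_of_notMem [FiniteDimensional K V] {E : Submodule K V} {x : V}
    (hx : x ∉ E) : Module.finrank K ↥(E ⊔ span K {x}) = Module.finrank K E + 1 := by
  have hx0 : x ≠ 0 := by rintro rfl; exact hx E.zero_mem
  have h := finrank_sup_add_finrank_inf_eq E (span K {x})
  have hd : Disjoint E (span K {x}) := (disjoint_span_singleton' hx0).2 hx
  rw [disjoint_iff.1 hd, finrank_bot, finrank_span_singleton hx0] at h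
  simpa using h

theorem exists_notMem_notMem {E F : Submodule K V} (hE : E ≠ ⊤) (hF : F ≠ ⊤) :
    ∃ x, x ∉ E ∧ x ∉ F := by
  by_contra! h
  obtain ⟨x, -, hx⟩ := SetLike.exists_of_lt (lt_top_iff_ne_top.2 hE)
  obtain ⟨y, -, hy⟩ := SetLike.exists_of_lt (lt_top_iff_ne_top.2 hF)
  have hxF := h x hx
  have hyE : y ∈ E := by
    by_contra hyE
    exact hy (h y hyE)
  have hxy : x + y ∉ E := fun hs => hx ((E.add_mem_iff_left hyE).1 hs)
  exact hy ((F.add_mem_iff_right hxF).1 (h _ hxy))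

/-- A subspace and a subspace of larger dimension have a common supplement that is a complement of
the former. -/
theorem exists_isCompl_codisjoint [FiniteDimensional K V] {E E' : Submodule K V}
    (h : Module.finrank K E ≤ Module.finrank K E') : ∃ F, IsCompl E F ∧ Codisjoint E' F := by
  by_cases hE' : E' = ⊤
  · obtain ⟨F, hF⟩ := exists_isCompl E
    exact ⟨F, hF, hE' ▸ codisjoint_top_left⟩
  have hlt := finrank_lt hE'
  have hE : E ≠ ⊤ := by
    rintro rfl
    rw [finrank_top] at h
    omega
  obtain ⟨x, hx, hx'⟩ := exists_notMem_notMem hE hE'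
  have hx0 : x ≠ 0 := by rintro rfl; exact hx E.zero_mem
  have h1 := finrank_sup_span_singleton_of_notMem hx
  have h2 := finrank_sup_span_singleton_of_notMem hx'
  obtain ⟨F, hF, hF'⟩ := exists_isCompl_codisjoint (E := E ⊔ span K {x}) (E' := E' ⊔ span K {x})
    (by omega)
  refine ⟨span K {x} ⊔ F, ⟨?_, ?_⟩, ?_⟩
  · exact Disjoint.disjoint_sup_right_of_disjoint_sup_left
      ((disjoint_span_singleton' hx0).2 hx) hF.disjoint
  · rw [codisjoint_iff, ← sup_assoc]
    exact hF.sup_eq_top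
  · rw [codisjoint_iff, ← sup_assoc]
    exact codisjoint_iff.1 hF'
termination_by Module.finrank K V - Module.finrank K E
decreasing_by
  have := finrank_lt hE
  omega

theorem isCompl_span_singleton [FiniteDimensional K V] {F : Submodule K V} {x : V}
    (hF : Module.finrank K F + 1 = Module.finrank K V) (hx : x ∉ F) : IsCompl F (span K {x}) := by
  have hx0 : x ≠ 0 := by rintro rfl; exact hx F.zero_mem
  refine ⟨(disjoint_span_singleton' hx0).2 hx, codisjoint_iff.2 ?_⟩
  refine eq_top_of_finrank_eq ?_
  rw [finrank_sup_span_singleton_of_notMem hx, hF]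

theorem exists_hyperplane [FiniteDimensional K V] {E : Submodule K V} {x : V} (hx : x ∉ E) :
    ∃ F : Submodule K V, Module.finrank K F + 1 = Module.finrank K V ∧ E ≤ F ∧ x ∉ F := by
  obtain ⟨l, hl, hE⟩ := exists_le_ker_of_notMem hx
  refine ⟨LinearMap.ker l, ?_, hE, hl⟩
  have hr : LinearMap.range l = ⊤ := by
    refine LinearMap.range_eq_top.2 fun c => ⟨(c * (l x)⁻¹) • x, ?_⟩
    simp [hl]
  have := LinearMap.finrank_range_add_finrank_ker l
  rw [hr, finrank_top, Module.finrank_self] at this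
  omega

end Submodule

/-- A surjective self-map of the subspace lattice that preserves complements and supplements. -/
structure PreservesComplements {K V : Type*} [Field K] [AddCommGroup V] [Module K V]
    (Φ : Submodule K V → Submodule K V) : Prop where
  surjective : Function.Surjective Φ
  isCompl : ∀ E F, IsCompl E F → IsCompl (Φ E) (Φ F)
  codisjoint : ∀ E F, Codisjoint E F → Codisjoint (Φ E) (Φ F)

theorem Submodule.exists_finrank_eq {K V : Type*} [Field K] [AddCommGroup V] [Module K V] {k : ℕ}
    (hk : k ≤ Module.finrank K V) : ∃ E : Submodule K V, Module.finrank K E = k := by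
  obtain ⟨s, hs⟩ := exists_finset_linearIndependent_of_le_finrank hk
  exact ⟨Submodule.span K s, by rw [finrank_span_finset_eq_card hs.2, hs.1]⟩

/-! ### From complement-preserving maps to collineations. -/

namespace PreservesComplements

open Submodule Module

variable {K V : Type*} [Field K] [AddCommGroup V] [Module K V] [FiniteDimensional K V]
  {Φ : Submodule K V → Submodule K V}

/-- For `F` a complement of `E` and a supplement of `E'`, the codimension of `Φ F` equals the
dimension of `Φ E` and is at most that of `Φ E'`. -/
theorem finrank_le_finrank_map (hΦ : PreservesComplements Φ) {E E' : Submodule K V}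
    (h : finrank K E ≤ finrank K E') : finrank K (Φ E) ≤ finrank K (Φ E') := by
  obtain ⟨F, hF, hF'⟩ := exists_isCompl_codisjoint h
  have h1 := finrank_add_eq_of_isCompl (hΦ.isCompl _ _ hF)
  have h2 := finrank_sup_add_finrank_inf_eq (Φ E') (Φ F)
  rw [codisjoint_iff.1 (hΦ.codisjoint _ _ hF'), finrank_top] at h2
  omega

theorem finrank_map (hΦ : PreservesComplements Φ) (E : Submodule K V) :
    finrank K (Φ E) = finrank K E := by
  have hE : ∀ k : Fin (finrank K V + 1), ∃ E : Submodule K V, finrank K E = k :=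
    fun k => exists_finrank_eq (Nat.lt_succ_iff.1 k.2)
  choose B hB using hE
  -- The dimension of `Φ E` is a monotone function `d` of the dimension of `E`. Surjectivity of `Φ`
  -- makes `d` surjective, and a monotone surjection of a finite chain to itself is the identity.
  let d : Fin (finrank K V + 1) → Fin (finrank K V + 1) :=
    fun k => ⟨finrank K (Φ (B k)), Nat.lt_succ_iff.2 (finrank_le _)⟩
  have hmono : Monotone d := fun j k hjk =>
    hΦ.finrank_le_finrank_map (by rw [hB, hB]; exact hjk)
  have hd : ∀ F : Submodule K V,
      d ⟨finrank K F, Nat.lt_succ_iff.2 (finrank_le _)⟩ =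
        ⟨finrank K (Φ F), Nat.lt_succ_iff.2 (finrank_le _)⟩ := fun F =>
    Fin.ext (le_antisymm (hΦ.finrank_le_finrank_map (hB _).le)
      (hΦ.finrank_le_finrank_map (hB ⟨finrank K F, _⟩).ge))
  have hsurj : Function.Surjective d := fun k => by
    obtain ⟨F, hF⟩ := hΦ.surjective (B k)
    exact ⟨_, (hd F).trans (Fin.ext ((congrArg (fun E : Submodule K V => finrank K E) hF).trans (hB k)))⟩
  have hstrict : StrictMono d :=
    hmono.strictMono_of_injective (Finite.injective_iff_surjective.2 hsurj)
  have h := hd E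
  rw [le_antisymm hstrict.apply_le hstrict.le_apply] at h
  exact (Fin.ext_iff.1 h).symm

theorem map_eq_bot (hΦ : PreservesComplements Φ) : Φ ⊥ = ⊥ :=
  finrank_eq_zero.1 (by rw [hΦ.finrank_map, finrank_bot])

/-- The action of `Φ` on lines, on the level of vectors. -/
theorem exists_representative (hΦ : PreservesComplements Φ) :
    ∃ g : V → V, g 0 = 0 ∧ ∀ v, Φ (span K {v}) = span K {g v} := by
  have h : ∀ v, ∃ w, (v = 0 → w = 0) ∧ Φ (span K {v}) = span K {w} := by
    intro v
    by_cases hv : v = 0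
    · subst hv
      exact ⟨0, fun _ => rfl, by simp [hΦ.map_eq_bot]⟩
    · obtain ⟨w, hw⟩ := (finrank_le_one_iff_isPrincipal (Φ (span K {v}))).1
        (by rw [hΦ.finrank_map, finrank_span_singleton hv])
      exact ⟨w, fun h => absurd h hv, hw⟩
  choose g hg using h
  exact ⟨g, (hg 0).1 rfl, fun v => (hg v).2⟩

section Representative

variable {g : V → V}

theorem representative_ne_zero (hΦ : PreservesComplements Φ)
    (hg : ∀ v, Φ (span K {v}) = span K {g v}) {v : V} (hv : v ≠ 0) : g v ≠ 0 := by
  intro h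
  have h1 := hΦ.finrank_map (span K {v})
  rw [hg, h, span_singleton_eq_bot.2 rfl, finrank_bot, finrank_span_singleton hv] at h1
  omega

theorem mem_of_representative_mem (hΦ : PreservesComplements Φ)
    (hg : ∀ v, Φ (span K {v}) = span K {g v}) {F : Submodule K V}
    (hF : finrank K F + 1 = finrank K V) {v : V} (h : g v ∈ Φ F) : v ∈ F := by
  by_contra hv
  have h1 := (hΦ.isCompl _ _ (isCompl_span_singleton hF hv)).disjoint
  rw [hg] at h1
  exact hΦ.representative_ne_zero hg (v := v) (by rintro rfl; exact hv F.zero_mem)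
    (disjoint_def.1 h1 _ h (mem_span_singleton_self _))

theorem exists_hyperplane_map_eq (hΦ : PreservesComplements Φ) {F : Submodule K V}
    (hF : finrank K F + 1 = finrank K V) :
    ∃ F' : Submodule K V, finrank K F' + 1 = finrank K V ∧ Φ F' = F := by
  obtain ⟨F', rfl⟩ := hΦ.surjective F
  exact ⟨F', by rwa [hΦ.finrank_map] at hF, rfl⟩

theorem exists_mem_span_representative (hΦ : PreservesComplements Φ)
    (hg : ∀ v, Φ (span K {v}) = span K {g v}) (z : V) :
    ∃ w, span K {z} = span K {g w} := by
  obtain ⟨E, hE⟩ := hΦ.surjective (span K {z})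
  have h1 : finrank K E ≤ 1 := by
    rw [← hΦ.finrank_map, hE]
    exact (finrank_span_le_card _).trans (by simp)
  obtain ⟨w, hw⟩ := (finrank_le_one_iff_isPrincipal E).1 h1
  exact ⟨w, by rw [← hg, ← hE, hw]⟩

/-- Otherwise the images lie in a hyperplane, which is `Φ F'` for a hyperplane `F'`, and `F'` would
contain the whole spanning family. -/
theorem span_representative_eq_top (hΦ : PreservesComplements Φ)
    (hg : ∀ v, Φ (span K {v}) = span K {g v}) {ι : Type*} {v : ι → V}
    (hv : span K (Set.range v) = ⊤) : span K (Set.range (g ∘ v)) = ⊤ := by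
  by_contra h
  obtain ⟨x, -, hx⟩ := SetLike.exists_of_lt (lt_top_iff_ne_top.2 h)
  obtain ⟨F, hF, hle, hxF⟩ := exists_hyperplane hx
  obtain ⟨F', hF', rfl⟩ := hΦ.exists_hyperplane_map_eq hF
  have : F' = ⊤ := by
    rw [eq_top_iff, ← hv, span_le]
    rintro _ ⟨i, rfl⟩
    exact hΦ.mem_of_representative_mem hg hF' (hle (subset_span ⟨i, rfl⟩))
  rw [this, finrank_top] at hF'
  omega

theorem linearIndependent_representative (hΦ : PreservesComplements Φ)
    (hg : ∀ v, Φ (span K {v}) = span K {g v}) {ι : Type*} {v : ι → V}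
    (hv : LinearIndependent K v) : LinearIndependent K (g ∘ v) := by
  -- The image of a basis spans and has as many members as the dimension, so it is independent.
  let b := Basis.sumExtend hv
  have hb : LinearIndependent K (g ∘ b) := by
    have : Finite (ι ⊕ _) := Module.Finite.finite_basis b
    have := Fintype.ofFinite (ι ⊕ Basis.sumExtendIndex hv)
    refine linearIndependent_of_top_le_span_of_card_eq_finrank
      (hΦ.span_representative_eq_top hg b.span_eq).ge (finrank_eq_card_basis b).symm
  have := hb.comp Sum.inl Sum.inl_injective
  have h2 : b ∘ Sum.inl = v := by
    ext i
    simp only [b, Basis.sumExtend, Function.comp_apply, Basis.reindex_apply, Basis.extend_apply_self]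
    rfl
  rwa [Function.comp_assoc, h2] at this

theorem mem_span_pair_of_representative (hΦ : PreservesComplements Φ) (hg0 : g 0 = 0)
    (hg : ∀ v, Φ (span K {v}) = span K {g v}) {x u v : V} (h : g x ∈ span K {g u, g v}) :
    x ∈ span K {u, v} := by
  have single : ∀ {x u : V}, g x ∈ span K {g u} → x ∈ span K {u} := by
    intro x u h
    by_cases hu : u = 0
    · subst hu
      rw [hg0, span_singleton_eq_bot.2 rfl, mem_bot] at h
      by_contra hx
      exact hΦ.representative_ne_zero hg (v := x) (by rintro rfl; exact hx (zero_mem _)) h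
    · by_contra hx
      have hli : LinearIndependent K ![u, x] := by
        rw [LinearIndependent.pair_iff' hu]
        exact fun c hc => hx (mem_span_singleton.2 ⟨c, hc⟩)
      have := hΦ.linearIndependent_representative hg hli
      rw [show g ∘ ![u, x] = ![g u, g x] by ext i; fin_cases i <;> rfl,
        LinearIndependent.pair_iff' (hΦ.representative_ne_zero hg hu)] at this
      obtain ⟨c, hc⟩ := mem_span_singleton.1 h
      exact this c hc
  have hspan : ∀ {u v : V} (c : K), v = c • u → span K {g u, g v} = span K {g u} := by
    rintro u _ c rfl
    refine le_antisymm (span_le.2 ?_) (span_mono (by simp))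
    rintro y (rfl | rfl)
    · exact mem_span_singleton_self _
    · by_cases hc : c = 0
      · simp [hc, hg0]
      · have := hg (c • u)
        rw [span_singleton_smul_eq (Ne.isUnit hc), hg] at this
        rw [this]
        exact mem_span_singleton_self _
  by_cases hu : u = 0
  · subst hu
    rw [hg0, span_insert_zero] at h
    rw [span_insert_zero]
    exact single h
  by_cases huv : LinearIndependent K ![u, v]
  · by_contra hx
    have hli : LinearIndependent K ![x, u, v] :=
      LinearIndependent.finCons (v := ![u, v]) huv (by simpa [Set.pair_comm] using hx)
    have := hΦ.linearIndependent_representative hg hli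
    rw [show g ∘ ![x, u, v] = ![g x, g u, g v] by ext i; fin_cases i <;> rfl] at this
    obtain ⟨p, q, hpq⟩ := mem_span_pair.1 h
    have := linearIndependent_triple_iff.1 this (-1) p q (by rw [← hpq]; module)
    simp at this
  · rw [LinearIndependent.pair_iff' hu] at huv
    push Not at huv
    obtain ⟨c, hc⟩ := huv
    rw [hspan c hc.symm] at h
    exact span_mono (by simp) (single h)

theorem representative_mem_iff (hΦ : PreservesComplements Φ) (hg0 : g 0 = 0)
    (hg : ∀ v, Φ (span K {v}) = span K {g v}) {F : Submodule K V}
    (hF : finrank K F + 1 = finrank K V) {v : V} : g v ∈ Φ F ↔ v ∈ F := by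
  refine ⟨hΦ.mem_of_representative_mem hg hF, fun hv => ?_⟩
  by_contra hn
  -- `S` is the union of the image lines of vectors of `F`; it is closed under addition because `g`
  -- reflects collinearity. It contains the hyperplane `Φ F` and also `g v` outside it, so it is
  -- everything, and reflecting back gives `F = ⊤`.
  let S : Submodule K V :=
    { carrier := {z | ∃ w ∈ F, z ∈ span K {g w}}
      zero_mem' := ⟨0, F.zero_mem, zero_mem _⟩
      smul_mem' := fun c z ⟨w, hw, hz⟩ => ⟨w, hw, smul_mem _ c hz⟩
      add_mem' := by
        rintro z₁ z₂ ⟨w₁, hw₁, hz₁⟩ ⟨w₂, hw₂, hz₂⟩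
        obtain ⟨w, hw⟩ := hΦ.exists_mem_span_representative hg (z₁ + z₂)
        refine ⟨w, ?_, hw ▸ mem_span_singleton_self _⟩
        have hle : span K {w₁, w₂} ≤ F := span_le.2 (by
          rintro y (rfl | rfl) <;> assumption)
        refine hle (hΦ.mem_span_pair_of_representative hg0 hg ?_)
        have h1 : g w ∈ span K {z₁ + z₂} := hw ▸ mem_span_singleton_self _
        refine (span_singleton_le_iff_mem _ _).2 ?_ h1
        exact add_mem (span_mono (by simp) hz₁) (span_mono (by simp) hz₂) }
  have hFS : Φ F ≤ S := by
    intro z hz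
    obtain ⟨w, hw⟩ := hΦ.exists_mem_span_representative hg z
    refine ⟨w, hΦ.mem_of_representative_mem hg hF ?_, hw ▸ mem_span_singleton_self _⟩
    exact (span_singleton_le_iff_mem _ _).2 hz (hw ▸ mem_span_singleton_self _)
  have hS : S = ⊤ := by
    rw [eq_top_iff, ← (isCompl_span_singleton (by rwa [hΦ.finrank_map]) hn).sup_eq_top]
    exact sup_le hFS ((span_singleton_le_iff_mem _ _).2 ⟨v, hv, mem_span_singleton_self _⟩)
  have hFtop : F = ⊤ := by
    rw [eq_top_iff]
    intro x _
    obtain ⟨w, hw, hx⟩ : g x ∈ S := hS ▸ mem_top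
    have := hΦ.mem_span_pair_of_representative hg0 hg (x := x) (u := w) (v := w) (by simpa using hx)
    exact span_le.2 (by rintro y (rfl | rfl) <;> exact hw) this
  rw [hFtop, finrank_top] at hF
  omega

theorem representsCollineation (hΦ : PreservesComplements Φ) (hg0 : g 0 = 0)
    (hg : ∀ v, Φ (span K {v}) = span K {g v}) : RepresentsCollineation K g where
  map_zero := hg0
  collinear x u v hx := by
    by_contra h
    obtain ⟨F, hF, hle, hxF⟩ := exists_hyperplane h
    obtain ⟨F', hF', rfl⟩ := hΦ.exists_hyperplane_map_eq hF
    have hu : u ∈ F' := (hΦ.representative_mem_iff hg0 hg hF').1 (hle (subset_span (by simp)))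
    have hv : v ∈ F' := (hΦ.representative_mem_iff hg0 hg hF').1 (hle (subset_span (by simp)))
    refine hxF ((hΦ.representative_mem_iff hg0 hg hF').2 (span_le.2 ?_ hx))
    rintro y (rfl | rfl) <;> assumption
  linearIndependent v hv := hΦ.linearIndependent_representative hg hv
  surjective z := by
    obtain ⟨w, hw⟩ := hΦ.exists_mem_span_representative hg z
    exact ⟨w, hw ▸ mem_span_singleton_self _⟩

end Representative

theorem le_of_map_le_hyperplane (hΦ : PreservesComplements Φ) {E F : Submodule K V}
    (hF : finrank K F + 1 = finrank K V) (h : Φ E ≤ Φ F) : E ≤ F := by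
  intro x hx
  by_contra hxF
  have hc : Codisjoint E F :=
    ((isCompl_span_singleton hF hxF).symm.codisjoint).mono_left
      ((span_singleton_le_iff_mem _ _).2 hx)
  have h1 := codisjoint_iff.1 (hΦ.codisjoint _ _ hc)
  rw [sup_eq_right.2 h] at h1
  rw [← hΦ.finrank_map, h1, finrank_top] at hF
  omega

/-- A surjective self-map of the subspace lattice that preserves complements and supplements is
induced by a semilinear automorphism. -/
theorem exists_semilinear (hΦ : PreservesComplements Φ) (hV : 3 ≤ finrank K V) :
    ∃ (σ : K ≃+* K) (T : V →ₛₗ[(σ : K →+* K)] V), Function.Bijective T ∧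
      ∀ E, Φ E = E.map T := by
  obtain ⟨g, hg0, hg⟩ := hΦ.exists_representative
  obtain ⟨σ, T, hT, hgT⟩ := (hΦ.representsCollineation hg0 hg).exists_semilinear hV
  refine ⟨σ, T, hT, fun E => ?_⟩
  have hmem : ∀ {F : Submodule K V}, finrank K F + 1 = finrank K V → ∀ v ∈ F, T v ∈ Φ F := by
    intro F hF v hv
    by_cases hv0 : v = 0
    · simp [hv0]
    · have h1 := mem_span_singleton_of_mem_of_ne_zero (hgT v) (hΦ.representative_ne_zero hg hv0)
      exact (span_singleton_le_iff_mem _ _).2 ((hΦ.representative_mem_iff hg0 hg hF).2 hv) h1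
  -- A vector outside `Φ E` is separated from it by a hyperplane, which reduces the inclusion to the
  -- hyperplane case `hmem`.
  have hle : ∀ E : Submodule K V, E.map T ≤ Φ E := by
    rintro E _ ⟨v, hv, rfl⟩
    by_contra h
    obtain ⟨F, hF, hEF, hx⟩ := exists_hyperplane h
    obtain ⟨F', hF', rfl⟩ := hΦ.exists_hyperplane_map_eq hF
    exact hx (hmem hF' v (hΦ.le_of_map_le_hyperplane hF' hEF hv))
  refine le_antisymm (fun y hy => ?_) (hle E)
  -- For the reverse inclusion, the component of a vector of `Φ E` along `F.map T` lies in `Φ E ⊓ Φ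
  -- F = ⊥`.
  obtain ⟨F, hF⟩ := Submodule.exists_isCompl E
  obtain ⟨v, rfl⟩ := hT.2 y
  obtain ⟨e, he, f, hf, rfl⟩ := mem_sup.1 (hF.sup_eq_top.ge (mem_top (x := v)))
  have h1 : T f ∈ Φ E := by
    rw [map_add] at hy
    exact ((Φ E).add_mem_iff_right (hle E (mem_map_of_mem he))).1 hy
  have h2 : T f = 0 := disjoint_def.1 (hΦ.isCompl _ _ hF).disjoint _ h1 (hle F (mem_map_of_mem hf))
  rw [map_add, h2, add_zero]
  exact mem_map_of_mem he

end PreservesComplements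

/-! ### The joint spectrum of two projections in terms of their ranges. -/

section JointSpectrum

variable {H : Type*} [NormedAddCommGroup H] [InnerProductSpace ℂ H]

theorem mem_jointSpectrum_pair {A B : H →L[ℂ] H} {c : Fin 2 → ℂ} :
    c ∈ jointSpectrum ![A, B] ↔ ¬ IsUnit (c 0 • A + c 1 • B) := by
  simp [jointSpectrum, Fin.sum_univ_two]

section InducedMap

variable {n : ℕ} (α : OrthonormalBasis (Fin n) ℂ H) (β : Module.Basis (Fin n) ℂ H) (f : ℂ ≃+* ℂ)

/-- `inducedMap` as a semilinear map. -/
noncomputable def inducedSemilinearMap : H →ₛₗ[(f : ℂ →+* ℂ)] H where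
  toFun := inducedMap α β f
  map_add' x y := by
    simp [inducedMap, add_smul, Finset.sum_add_distrib]
  map_smul' c x := by
    simp [inducedMap, mul_smul, Finset.smul_sum]

theorem inducedSemilinearMap_bijective : Function.Bijective (inducedSemilinearMap α β f) := by
  constructor
  · rw [injective_iff_map_eq_zero]
    intro x hx
    have h := Fintype.linearIndependent_iff.1 β.linearIndependent (fun i => f (α.repr x i)) hx
    refine α.repr.injective ?_
    ext i
    simpa using h i
  · intro y
    refine ⟨∑ i, f.symm (β.repr y i) • α i, ?_⟩
    rw [map_sum]
    have hα : ∀ i, inducedSemilinearMap α β f (α i) = β i := fun i => by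
      simp [inducedSemilinearMap, inducedMap]
    conv_rhs => rw [← β.sum_repr y]
    refine Finset.sum_congr rfl fun i _ => ?_
    rw [LinearMap.map_smulₛₗ, hα]
    simp

end InducedMap

theorem coe_map_range_eq {n : ℕ} {α : OrthonormalBasis (Fin n) ℂ H}
    {β : Module.Basis (Fin n) ℂ H} {f : ℂ ≃+* ℂ} {T : H →ₛₗ[(f : ℂ →+* ℂ)] H}
    (h : ∀ x, T x = inducedMap α β f x) (P : H →L[ℂ] H) :
    (P.range.map T : Set H) = {η : H | ∃ ξ : H, η = inducedMap α β f (P ξ)} := by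
  ext η
  simp [h, eq_comm]

theorem exists_eq_inducedMap [FiniteDimensional ℂ H] {n : ℕ} (hn : Module.finrank ℂ H = n) {σ : ℂ ≃+* ℂ}
    {T : H →ₛₗ[(σ : ℂ →+* ℂ)] H} (hT : Function.Bijective T) :
    ∃ (α : OrthonormalBasis (Fin n) ℂ H) (β : Module.Basis (Fin n) ℂ H),
      ∀ x, T x = inducedMap α β σ x := by
  subst hn
  -- Any orthonormal basis would serve, with `β` its image under `T`.
  let α := stdOrthonormalBasis ℂ H
  have hli : LinearIndependent ℂ (fun i => T (α i)) := by
    rw [Fintype.linearIndependent_iff]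
    intro c hc i
    have h1 : T (∑ i, σ.symm (c i) • α i) = 0 := by
      rw [map_sum, ← hc]
      refine Finset.sum_congr rfl fun i _ => ?_
      rw [LinearMap.map_smulₛₗ]
      simp
    have h2 := Fintype.linearIndependent_iff.1 α.toBasis.linearIndependent (fun i => σ.symm (c i))
      (by simpa using (map_eq_zero_iff T hT.1).1 h1) i
    simpa using h2
  refine ⟨α, basisOfLinearIndependentOfCardEqFinrank' _ hli (by simp), fun x => ?_⟩
  conv_lhs => rw [← α.sum_repr x]
  rw [map_sum]
  refine Finset.sum_congr rfl fun i _ => ?_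
  rw [LinearMap.map_smulₛₗ]
  simp

variable [CompleteSpace H]

theorem IsStarProjection.apply_of_mem_range {P : H →L[ℂ] H} (hP : IsStarProjection P) {x : H}
    (hx : x ∈ P.range) : P x = x := by
  obtain ⟨y, rfl⟩ := hx
  exact DFunLike.congr_fun hP.isIdempotentElem y

theorem IsStarProjection.inner_apply_left {P : H →L[ℂ] H} (hP : IsStarProjection P) (x y : H) :
    inner ℂ (P x) y = inner ℂ x (P y) :=
  hP.isSelfAdjoint.isSymmetric x y

theorem isUnit_combination_iff [FiniteDimensional ℂ H] {P Q : H →L[ℂ] H} (hP : IsStarProjection P)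
    (hQ : IsStarProjection Q) (a b : ℂ) :
    IsUnit (a • P + b • Q) ↔ P.range ⊔ Q.range = ⊤ ∧ (a + b = 0 → P.range ⊓ Q.range = ⊥) ∧
      (a = 0 → Q.range = ⊤) ∧ (b = 0 → P.range = ⊤) := by
  rw [ContinuousLinearMap.isUnit_iff_bijective]
  constructor
  · rintro ⟨hinj, hsurj⟩
    refine ⟨?_, fun hab => ?_, ?_, ?_⟩
    · rw [eq_top_iff]
      intro x _
      obtain ⟨y, rfl⟩ := hsurj x
      exact Submodule.add_mem_sup (Submodule.smul_mem _ a ⟨y, rfl⟩)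
        (Submodule.smul_mem _ b ⟨y, rfl⟩)
    · rw [eq_bot_iff]
      rintro x ⟨h1, h2⟩
      refine hinj ?_
      change a • P x + b • Q x = (a • P + b • Q) 0
      rw [map_zero, hP.apply_of_mem_range h1, hQ.apply_of_mem_range h2, ← add_smul, hab, zero_smul]
    · rintro rfl
      rw [eq_top_iff]
      intro x _
      obtain ⟨y, rfl⟩ := hsurj x
      have : b • Q y ∈ Q.range := Submodule.smul_mem _ b ⟨y, rfl⟩
      simpa using this
    · rintro rfl
      rw [eq_top_iff]
      intro x _
      obtain ⟨y, rfl⟩ := hsurj x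
      have : a • P y ∈ P.range := Submodule.smul_mem _ a ⟨y, rfl⟩
      simpa using this
  · rintro ⟨hsup, hdisj, ha, hb⟩
    have hinj : Function.Injective (a • P + b • Q) := by
      rw [injective_iff_map_eq_zero]
      intro x hx
      have hx' : a • P x + b • Q x = 0 := hx
      by_cases ha0 : a = 0
      · have hQx := hQ.apply_of_mem_range ((ha ha0).ge (Submodule.mem_top (x := x)))
        -- If both coefficients vanish, the conditions force `⊤ = ⊥`, so `H` is trivial.
        by_cases hb0 : b = 0
        · have h := hdisj (by rw [ha0, hb0, add_zero])
          rw [ha ha0, hb hb0, inf_top_eq] at h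
          exact (Submodule.mem_bot ℂ).1 (h.le Submodule.mem_top)
        · rw [ha0, zero_smul, zero_add, hQx] at hx'
          exact (smul_eq_zero.1 hx').resolve_left hb0
      by_cases hb0 : b = 0
      · have hPx := hP.apply_of_mem_range ((hb hb0).ge (Submodule.mem_top (x := x)))
        rw [hb0, zero_smul, add_zero, hPx] at hx'
        exact (smul_eq_zero.1 hx').resolve_left ha0
      -- The vector `y = a • P x = -(b • Q x)` lies in both ranges. Pairing it with `x` gives `a⟪y,
      -- x⟫ = ⟪y, y⟫ = -b⟪y, x⟫`, so `y = 0` unless `a + b = 0`, where the trivial intersection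
      -- applies.
      have hy : a • P x = 0 := by
        have hmemP : a • P x ∈ P.range := Submodule.smul_mem _ a ⟨x, rfl⟩
        have hmemQ : a • P x ∈ Q.range := by
          rw [eq_neg_of_add_eq_zero_left hx']
          exact neg_mem (Submodule.smul_mem _ b ⟨x, rfl⟩)
        by_cases hab : a + b = 0
        · have : a • P x ∈ P.range ⊓ Q.range := ⟨hmemP, hmemQ⟩
          rwa [hdisj hab, Submodule.mem_bot] at this
        · set y := a • P x with hy
          have hy' : b • Q x = -y := eq_neg_of_add_eq_zero_right hx'
          have h1 : a * inner ℂ y x = inner ℂ y y := by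
            nth_rw 1 [← hP.apply_of_mem_range hmemP]
            rw [hP.inner_apply_left, ← inner_smul_right, ← hy]
          have h2 : b * inner ℂ y x = -inner ℂ y y := by
            nth_rw 1 [← hQ.apply_of_mem_range hmemQ]
            rw [hQ.inner_apply_left, ← inner_smul_right, hy', inner_neg_right]
          have h3 : (a + b) * inner ℂ y x = 0 := by linear_combination h1 + h2
          rw [(mul_eq_zero.1 h3).resolve_left hab, mul_zero] at h1
          exact inner_self_eq_zero.1 h1.symm
      have hPx : P x = 0 := (smul_eq_zero.1 hy).resolve_left ha0
      have hQx : Q x = 0 := by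
        rw [hy, zero_add] at hx'
        exact (smul_eq_zero.1 hx').resolve_left hb0
      -- A vector killed by `P` and `Q` is orthogonal to both ranges, hence to their sum `H`.
      obtain ⟨_, ⟨e, rfl⟩, _, ⟨f, rfl⟩, hef⟩ :=
        Submodule.mem_sup.1 (hsup.ge (Submodule.mem_top (x := x)))
      rw [← inner_self_eq_zero (𝕜 := ℂ)]
      nth_rw 1 [← hef]
      rw [inner_add_left]
      erw [hP.inner_apply_left, hQ.inner_apply_left]
      simp [hPx, hQx]
    exact ⟨hinj, LinearMap.surjective_of_injective (f := (a • P + b • Q).toLinearMap) hinj⟩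

namespace Projections

/-- The orthogonal projection onto a closed subspace. -/
noncomputable def ofSubmodule (E : Submodule ℂ H) [E.HasOrthogonalProjection] : Projections H :=
  ⟨E.starProjection, isStarProjection_starProjection⟩

theorem range_ofSubmodule (E : Submodule ℂ H) [E.HasOrthogonalProjection] :
    (ofSubmodule E).1.range = E :=
  E.range_starProjection

theorem ofSubmodule_range [FiniteDimensional ℂ H] (P : Projections H) :
    ofSubmodule P.1.range = P :=
  Subtype.ext (ContinuousLinearMap.IsStarProjection.ext isStarProjection_starProjection P.2
    (Submodule.range_starProjection _))

end Projections

theorem ShrinksJointSpectrumOfPairs.isUnit_combination {φ : Projections H → Projections H}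
    (h : ShrinksJointSpectrumOfPairs φ) {P Q : Projections H} {a b : ℂ}
    (hu : IsUnit (a • P.1 + b • Q.1)) : IsUnit (a • (φ P).1 + b • (φ Q).1) := by
  by_contra hn
  have h1 : ![a, b] ∈ jointSpectrum ![(φ P).1, (φ Q).1] := mem_jointSpectrum_pair.2 hn
  exact mem_jointSpectrum_pair.1 (h P Q h1) hu

variable [FiniteDimensional ℂ H]

theorem ShrinksJointSpectrumOfPairs.preservesComplements {φ : Projections H → Projections H}
    (h : ShrinksJointSpectrumOfPairs φ) (hφ : Function.Surjective φ) :
    PreservesComplements fun E : Submodule ℂ H => (φ (Projections.ofSubmodule E)).1.range := by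
  have hcod : ∀ E F : Submodule ℂ H, Codisjoint E F →
      Codisjoint (φ (Projections.ofSubmodule E)).1.range
        (φ (Projections.ofSubmodule F)).1.range := by
    intro E F hEF
    have h1 := h.isUnit_combination (P := Projections.ofSubmodule E)
      (Q := Projections.ofSubmodule F) (a := 1) (b := 1)
    rw [isUnit_combination_iff (Subtype.prop _) (Subtype.prop _),
      isUnit_combination_iff (Subtype.prop _) (Subtype.prop _), Projections.range_ofSubmodule,
      Projections.range_ofSubmodule] at h1
    exact codisjoint_iff.2 (h1 ⟨codisjoint_iff.1 hEF, by norm_num, by simp, by simp⟩).1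
  refine ⟨fun F => ?_, fun E F hEF => ⟨?_, hcod E F hEF.codisjoint⟩, hcod⟩
  · obtain ⟨P, hP⟩ := hφ (Projections.ofSubmodule F)
    refine ⟨P.1.range, ?_⟩
    simp only [Projections.ofSubmodule_range, hP, Projections.range_ofSubmodule]
  -- Coefficients with sum zero are the ones that detect the intersection of the ranges.
  · have h1 := h.isUnit_combination (P := Projections.ofSubmodule E)
      (Q := Projections.ofSubmodule F) (a := 1) (b := -1)
    rw [isUnit_combination_iff (Subtype.prop _) (Subtype.prop _),
      isUnit_combination_iff (Subtype.prop _) (Subtype.prop _), Projections.range_ofSubmodule,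
      Projections.range_ofSubmodule] at h1
    exact disjoint_iff.2 ((h1 ⟨hEF.sup_eq_top, fun _ => hEF.inf_eq_bot, by simp, by simp⟩).2.1
      (by norm_num))

theorem preservesJointSpectrumOfPairs_of_range_eq_map {φ : Projections H → Projections H}
    {σ : ℂ ≃+* ℂ} {T : H →ₛₗ[(σ : ℂ →+* ℂ)] H} (hT : Function.Bijective T)
    (h : ∀ P, (φ P).1.range = P.1.range.map T) : PreservesJointSpectrumOfPairs φ := by
  have htop : ∀ E : Submodule ℂ H, E.map T = ⊤ ↔ E = ⊤ := by
    intro E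
    have h1 : (⊤ : Submodule ℂ H).map T = ⊤ := by
      rw [Submodule.map_top, LinearMap.range_eq_top.2 hT.2]
    rw [← (Submodule.map_injective_of_injective hT.1).eq_iff (a := E), h1]
  have hbot : ∀ E : Submodule ℂ H, E.map T = ⊥ ↔ E = ⊥ := by
    intro E
    rw [← (Submodule.map_injective_of_injective hT.1).eq_iff (a := E), Submodule.map_bot]
  intro P Q
  ext c
  rw [mem_jointSpectrum_pair, mem_jointSpectrum_pair, isUnit_combination_iff P.2 Q.2,
    isUnit_combination_iff (φ P).2 (φ Q).2, h, h, ← Submodule.map_sup,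
    ← Submodule.map_inf T hT.1, htop, htop, htop, hbot]

end JointSpectrum

theorem theorem1p1 {H : Type*} [NormedAddCommGroup H] [InnerProductSpace ℂ H]
    [CompleteSpace H] [FiniteDimensional ℂ H] (n : ℕ) (hdim : Module.finrank ℂ H = n)
    (hn : 3 ≤ n) (φ : Projections H → Projections H) (hφ : Function.Surjective φ) :
    List.TFAE
      [ShrinksJointSpectrumOfPairs φ,
       PreservesJointSpectrumOfPairs φ,
       ∃ (α : OrthonormalBasis (Fin n) ℂ H) (β : Module.Basis (Fin n) ℂ H) (f : ℂ ≃+* ℂ),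
         ∀ P : Projections H,
           Set.range (φ P).1 = {η : H | ∃ ξ : H, η = inducedMap α β f (P.1 ξ)}] := by
  tfae_have 2 → 1 := fun h P Q => (h P Q).subset
  tfae_have 1 → 3 := by
    intro h
    obtain ⟨σ, T, hT, hmap⟩ := (h.preservesComplements hφ).exists_semilinear (hdim ▸ hn)
    obtain ⟨α, β, hαβ⟩ := exists_eq_inducedMap hdim hT
    refine ⟨α, β, σ, fun P => ?_⟩
    rw [← coe_map_range_eq hαβ, ← hmap, Projections.ofSubmodule_range]
    rfl
  tfae_have 3 → 2 := by
    rintro ⟨α, β, f, h⟩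
    refine preservesJointSpectrumOfPairs_of_range_eq_map (inducedSemilinearMap_bijective α β f)
      fun P => SetLike.coe_injective ?_
    rw [coe_map_range_eq (fun _ => rfl), ← h]
    rfl
  tfae_finish
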